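/- Let $1\le d\le n$ be integers, let $a_1,\dots,a_n\in\mathbb{R}^d$ be arbitrary vectors, and let $\lambda>0$. Define the optimal value of the regularized A-optimal design problem (RAOD) with selection size $d$, $$z_d:=\min_{S\subseteq\{1,\dots,n\},\ |S|=d}\operatorname{tr}\Big(\Big(\sum_{i\in S}a_ia_i^{\top}+\lambda I_d\Big)^{-1}\Big),$$ and the optimal value of its conventional continuous relaxation (RAOD-RI), $$\nu^{C}_d:=\min\Big\{\operatorname{tr}\Big(\Big(\sum_{i=1}^n x_ia_ia_i^{\top}+\lambda I_d\Big)^{-1}\Big):\ x\in[0,1]^n,\ \sum_{i=1}^n x_i=d\Big\}.$$ Then both minima are attained, $\nu^{C}_d>0$, and $$1\le\frac{z_d}{\nu^{C}_d}\le\min\{d,\;n-d+1\}.$$ -/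

import Mathlib

/-- The objective of a set of chosen experiments:
`f(S) = tr ((∑_{i ∈ S} a_i a_iᵀ + lam I_d)⁻¹)`. -/
noncomputable def raodObjective {n d : ℕ} (a : Fin n → Fin d → ℝ) (lam : ℝ)
    (S : Finset (Fin n)) : ℝ :=
  Matrix.trace
    ((∑ i ∈ S, Matrix.vecMulVec (a i) (a i)) + lam • (1 : Matrix (Fin d) (Fin d) ℝ))⁻¹

/-- The objective at a fractional vector of weights:
`tr ((∑_i x_i a_i a_iᵀ + lam I_d)⁻¹)`. -/
noncomputable def raodRIObjective {n d : ℕ} (a : Fin n → Fin d → ℝ) (lam : ℝ)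
    (x : Fin n → ℝ) : ℝ :=
  Matrix.trace
    ((∑ i, x i • Matrix.vecMulVec (a i) (a i)) + lam • (1 : Matrix (Fin d) (Fin d) ℝ))⁻¹

/-- The objective values of RAOD: those of the sets `S ⊆ [n]` with `|S| = k`. -/
def raodValues {n d : ℕ} (a : Fin n → Fin d → ℝ) (lam : ℝ) (k : ℕ) : Set ℝ :=
  raodObjective a lam '' {S : Finset (Fin n) | S.card = k}

/-- The objective values of RAOD-RI: those of the `x ∈ [0,1]^n` with `∑_i x_i = k`. -/
def raodRIValues {n d : ℕ} (a : Fin n → Fin d → ℝ) (lam : ℝ) (k : ℕ) : Set ℝ :=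
  raodRIObjective a lam ''
    {x : Fin n → ℝ | (∀ i, x i ∈ Set.Icc (0 : ℝ) 1) ∧ ∑ i, x i = (k : ℝ)}

/-- The optimal value `z_k` of RAOD. -/
noncomputable def raodOpt {n d : ℕ} (a : Fin n → Fin d → ℝ) (lam : ℝ) (k : ℕ) : ℝ :=
  sInf (raodValues a lam k)

/-- The optimal value `ν^C_k` of the conventional relaxation RAOD-RI. -/
noncomputable def raodRIOpt {n d : ℕ} (a : Fin n → Fin d → ℝ) (lam : ℝ) (k : ℕ) : ℝ :=
  sInf (raodRIValues a lam k)

/-! The upper bound comes from volume sampling. Let `x` be a feasible fractional design with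
information matrix `A`, and put `M = A + lam • 1`. Draw a `d`-tuple `f` with weight `∏ x (f k) * det
(C_f) ^ 2`, where the rows of `C_f` are the chosen vectors; tuples with a repetition get weight
zero. The best set is at most the weighted average.

For each basis vector `e`, let `z = M⁻¹ e` and split `e = A z + lam z`. The form of `(C_fᵀ C_f +
lam)⁻¹` at `e` is at most `|C_f⁻ᵀ A z|² + lam |z|²`. By Cramer, the first term times `det (C_f) ^ 2`
is a sum of squared determinants with one row replaced by `A z`. Cauchy–Binet evaluates their sum
over all tuples, giving a factor `∑ x = d`. An exchange argument improves `d` to `min d (n - d + 1)`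
when only injective tuples count (`sum_injective_det_updateRow_sq_le`). Summing over `e` recovers
`tr M⁻¹`.

Singular `A` is reached by perturbing the vectors. The lower bound holds because indicators of sets
are feasible. -/

/-- The **Cauchy–Binet formula** with a separate weighted family of vectors for each row. -/
theorem Matrix.sum_prod_mul_det_sq {m ι : Type*} [Fintype m] [DecidableEq m] [Fintype ι]
    (c : m → ι → m → ℝ) (y : m → ι → ℝ) :
    ∑ f : m → ι, (∏ k, y k (f k)) * (Matrix.of fun k => c k (f k)).det ^ 2 =
      ∑ σ : Equiv.Perm m, (Equiv.Perm.sign σ : ℝ) *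
        (Matrix.of fun k l => ∑ i, y k i * c k i (σ k) * c k i l).det := by
  classical
  -- Multilinearity in the rows; the identity then follows by Leibniz-expanding one factor of the
  -- squared determinant.
  have expand : ∀ σ : Equiv.Perm m,
      (Matrix.of fun k l => ∑ i, y k i * c k i (σ k) * c k i l).det =
        ∑ f : m → ι, (∏ k, y k (f k) * c k (f k) (σ k)) *
          (Matrix.of fun k => c k (f k)).det := by
    intro σ
    have h : (Matrix.of fun k l => ∑ i, y k i * c k i (σ k) * c k i l) =
        fun k => ∑ i, (y k i * c k i (σ k)) • c k i := by
      ext k l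
      simp [Finset.sum_apply]
    have h1 := (Matrix.detRowAlternating (R := ℝ) (n := m)).toMultilinearMap.map_sum
      (fun k i => (y k i * c k i (σ k)) • c k i)
    rw [h]
    refine h1.trans (Finset.sum_congr rfl fun f _ => ?_)
    exact (Matrix.detRowAlternating (R := ℝ) (n := m)).toMultilinearMap.map_smul_univ _ _
  simp_rw [expand, Finset.mul_sum]
  rw [Finset.sum_comm]
  refine Finset.sum_congr rfl fun f _ => ?_
  have hdet : (Matrix.of fun k => c k (f k)).det =
      ∑ σ : Equiv.Perm m, (Equiv.Perm.sign σ : ℝ) * ∏ k, c k (f k) (σ k) := by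
    rw [← Matrix.det_transpose, Matrix.det_apply']
    rfl
  rw [sq]
  nth_rewrite 1 [hdet]
  rw [Finset.sum_mul, Finset.mul_sum]
  refine Finset.sum_congr rfl fun σ _ => ?_
  rw [Finset.prod_mul_distrib]
  ring

/-! ### Information matrices and volume-weighted sums -/

section VolumeSampling

open scoped Matrix

variable {n d : ℕ}

/-- The information matrix of a fractional design. -/
noncomputable def informationMatrix (a : Fin n → Fin d → ℝ) (x : Fin n → ℝ) :
    Matrix (Fin d) (Fin d) ℝ :=
  ∑ i, x i • Matrix.vecMulVec (a i) (a i)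

theorem informationMatrix_apply (a : Fin n → Fin d → ℝ) (x : Fin n → ℝ) (k l : Fin d) :
    informationMatrix a x k l = ∑ i, x i * a i k * a i l := by
  simp [informationMatrix, Matrix.sum_apply, Matrix.vecMulVec_apply, mul_assoc]

theorem informationMatrix_transpose (a : Fin n → Fin d → ℝ) (x : Fin n → ℝ) :
    (informationMatrix a x).transpose = informationMatrix a x := by
  ext k l
  simp only [Matrix.transpose_apply, informationMatrix_apply]
  exact Finset.sum_congr rfl fun i _ => by ring

theorem informationMatrix_posSemidef (a : Fin n → Fin d → ℝ) {x : Fin n → ℝ}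
    (hx : ∀ i, 0 ≤ x i) : (informationMatrix a x).PosSemidef := by
  refine Matrix.posSemidef_sum _ fun i _ => Matrix.PosSemidef.smul ?_ (hx i)
  simpa using Matrix.posSemidef_vecMulVec_self_star (a i)

theorem informationMatrix_add_posDef (a : Fin n → Fin d → ℝ) {x : Fin n → ℝ}
    (hx : ∀ i, 0 ≤ x i) {lam : ℝ} (hlam : 0 < lam) :
    (informationMatrix a x + lam • (1 : Matrix (Fin d) (Fin d) ℝ)).PosDef :=
  Matrix.PosDef.posSemidef_add (informationMatrix_posSemidef a hx) (Matrix.PosDef.one.smul hlam)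

/-- Normalizing constant of volume sampling: every `σ` in Cauchy–Binet contributes the same term,
since the sign of the row permutation cancels. -/
theorem sum_volume_weights (a : Fin n → Fin d → ℝ) (x : Fin n → ℝ) :
    ∑ f : Fin d → Fin n, (∏ k, x (f k)) * (Matrix.of fun k => a (f k)).det ^ 2 =
      (d.factorial : ℝ) * (informationMatrix a x).det := by
  have h := Matrix.sum_prod_mul_det_sq (fun (_ : Fin d) => a) (fun _ => x)
  rw [h]
  have h2 : ∀ σ : Equiv.Perm (Fin d), (Equiv.Perm.sign σ : ℝ) *
      (Matrix.of fun k l => ∑ i, x i * a i (σ k) * a i l).det = (informationMatrix a x).det := by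
    intro σ
    have h3 : (Matrix.of fun k l => ∑ i, x i * a i (σ k) * a i l) =
        (informationMatrix a x).submatrix σ id := by
      ext k l
      simp [informationMatrix_apply]
    rw [h3, Matrix.det_permute, ← mul_assoc]
    norm_cast
    simp
  simp [h2, Fintype.card_perm]

/-- Cauchy–Binet with the constant family `A z` in row `j`. The idle index `f j` yields `∑ x`, and
Cramer's rule for the system with right-hand side `A z` returns the coordinates of `z`. -/
theorem sum_det_updateRow_sq (a : Fin n → Fin d → ℝ) (x : Fin n → ℝ) (z : Fin d → ℝ) :
    ∑ j, ∑ f : Fin d → Fin n, (∏ k, x (f k)) *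
        ((Matrix.of fun k => a (f k)).updateRow j (informationMatrix a x *ᵥ z)).det ^ 2 =
      (∑ i, x i) * (d.factorial : ℝ) * (informationMatrix a x).det *
        (informationMatrix a x *ᵥ z ⬝ᵥ z) := by
  set A := informationMatrix a x with hA
  set u := A *ᵥ z with hu
  have key : ∀ j, ∑ f : Fin d → Fin n, (∏ k, x (f k)) *
        ((Matrix.of fun k => a (f k)).updateRow j u).det ^ 2 =
      ∑ σ : Equiv.Perm (Fin d), (∑ i, x i) * A.det * (u (σ j) * z (σ j)) := by
    intro j
    have h := Matrix.sum_prod_mul_det_sq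
      (fun (k : Fin d) i => if k = j then u else a i) (fun _ => x)
    have h1 : ∀ f : Fin d → Fin n, (Matrix.of fun k => if k = j then u else a (f k)) =
        (Matrix.of fun k => a (f k)).updateRow j u := by
      intro f
      ext k l
      by_cases hk : k = j <;> simp [Matrix.updateRow_apply, hk]
    simp only [h1] at h
    rw [h]
    refine Finset.sum_congr rfl fun σ _ => ?_
    have h3 : (Matrix.of fun k l => ∑ i, x i * (if k = j then u else a i) (σ k) *
        (if k = j then u else a i) l) =
        (A.updateRow (σ j) (((∑ i, x i) * u (σ j)) • u)).submatrix σ id := by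
      ext k l
      by_cases hk : k = j
      · subst hk
        simp [Finset.sum_mul, mul_assoc]
      · have : σ k ≠ σ j := fun h => hk (σ.injective h)
        simp [hk, Matrix.updateRow_apply, hA, informationMatrix_apply]
    have h4 : (A.updateRow (σ j) u).det = A.det * z (σ j) := by
      rw [← Matrix.cramer_transpose_apply, hA, informationMatrix_transpose, ← hA,
        Matrix.cramer_eq_adjugate_mulVec, hu, Matrix.mulVec_mulVec, Matrix.adjugate_mul,
        Matrix.smul_mulVec, Matrix.one_mulVec]
      simp
    rw [h3, Matrix.det_permute, ← mul_assoc, Matrix.det_updateRow_smul, h4]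
    have : (Equiv.Perm.sign σ : ℝ) * (Equiv.Perm.sign σ : ℝ) = 1 := by
      norm_cast
      simp
    rw [this]
    ring
  simp_rw [key]
  rw [Finset.sum_comm]
  have h5 : ∀ σ : Equiv.Perm (Fin d),
      ∑ j, (∑ i, x i) * A.det * (u (σ j) * z (σ j)) = (∑ i, x i) * A.det * (u ⬝ᵥ z) := by
    intro σ
    rw [← Finset.mul_sum, Equiv.sum_comp σ fun l => u l * z l]
    rfl
  simp [h5, Fintype.card_perm]
  ring

/-! ### Restriction to injective tuples -/

/-- An admissible `i` avoids the `d - 1` distinct values of `f` off `j`, so at most `n - d + 1`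
weights, each at most 1, occur; their total is also at most `d`. -/
theorem sum_injective_update_le {x : Fin n → ℝ} (hx : ∀ i, x i ∈ Set.Icc (0 : ℝ) 1)
    (hsum : ∑ i, x i = d) (hdn : d ≤ n) (f : Fin d → Fin n) (j : Fin d) :
    ∑ i, (if Function.Injective (Function.update f j i) then x i else 0) ≤
      min (d : ℝ) ((n : ℝ) - d + 1) := by
  classical
  rw [← Finset.sum_filter]
  refine le_min ?_ ?_
  · rw [← hsum]
    exact Finset.sum_le_sum_of_subset_of_nonneg (Finset.filter_subset _ _)
      fun i _ _ => (hx i).1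
  · set G := Finset.univ.filter fun i => Function.Injective (Function.update f j i)
    have hcard : G.card + d ≤ n + 1 := by
      rcases G.eq_empty_or_nonempty with h | ⟨i, hi⟩
      · simp [h]; omega
      · have hi := (Finset.mem_filter.1 hi).2
        have himg : ((Finset.univ.erase j).image f).card = d - 1 := by
          rw [Finset.card_image_of_injOn, Finset.card_erase_of_mem (Finset.mem_univ _),
            Finset.card_univ, Fintype.card_fin]
          intro k hk l hl hkl
          have hk : k ≠ j := by simpa using hk
          have hl : l ≠ j := by simpa using hl
          exact hi (by simpa [Function.update_of_ne, hk, hl] using hkl)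
        have hdisj : Disjoint G ((Finset.univ.erase j).image f) := by
          rw [Finset.disjoint_left]
          intro l hl hl'
          obtain ⟨k, hk, rfl⟩ := Finset.mem_image.1 hl'
          have hk : k ≠ j := by simpa using hk
          have := (Finset.mem_filter.1 hl).2
          exact hk (this (by simp [Function.update_of_ne, hk]))
        have := Finset.card_le_univ (G ∪ (Finset.univ.erase j).image f)
        rw [Finset.card_union_of_disjoint hdisj, himg, Fintype.card_fin] at this
        omega
    calc ∑ i ∈ G, x i ≤ ∑ i ∈ G, (1 : ℝ) := Finset.sum_le_sum fun i _ => (hx i).2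
      _ = G.card := by simp
      _ ≤ n - d + 1 := by
        have : (G.card : ℝ) + d ≤ n + 1 := by exact_mod_cast hcard
        linarith

/-- The determinant ignores `f j`. Writing `d` as `∑ i, x i` and exchanging `i` with `f j` moves the
injectivity condition onto the free index `i`, where the previous bound applies. -/
theorem sum_injective_det_updateRow_sq_le {x : Fin n → ℝ}
    (hx : ∀ i, x i ∈ Set.Icc (0 : ℝ) 1) (hsum : ∑ i, x i = d) (hdn : d ≤ n)
    (a : Fin n → Fin d → ℝ) (u : Fin d → ℝ) (j : Fin d) :
    (d : ℝ) * ∑ f : Fin d → Fin n, (if Function.Injective f then (∏ k, x (f k)) *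
        ((Matrix.of fun k => a (f k)).updateRow j u).det ^ 2 else 0) ≤
      min (d : ℝ) ((n : ℝ) - d + 1) * ∑ f : Fin d → Fin n, (∏ k, x (f k)) *
        ((Matrix.of fun k => a (f k)).updateRow j u).det ^ 2 := by
  classical
  set D : (Fin d → Fin n) → ℝ := fun f =>
    ((Matrix.of fun k => a (f k)).updateRow j u).det ^ 2
  set P : (Fin d → Fin n) → ℝ := fun f => ∏ k ∈ Finset.univ.erase j, x (f k)
  have hprod : ∀ f, ∏ k, x (f k) = x (f j) * P f := fun f =>
    (Finset.mul_prod_erase Finset.univ (fun k => x (f k)) (Finset.mem_univ j)).symm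
  have hD : ∀ f i, D (Function.update f j i) = D f := by
    intro f i
    have : (Matrix.of fun k => a (Function.update f j i k)).updateRow j u =
        (Matrix.of fun k => a (f k)).updateRow j u := by
      ext k l
      by_cases hk : k = j <;> simp [Matrix.updateRow_apply, hk]
    simp only [D, this]
  have hP : ∀ f i, P (Function.update f j i) = P f := fun f i =>
    Finset.prod_congr rfl fun k hk => by
      rw [Function.update_of_ne (Finset.ne_of_mem_erase hk)]
  let swap : (Fin d → Fin n) × Fin n → (Fin d → Fin n) × Fin n :=
    fun p => (Function.update p.1 j p.2, p.1 j)
  have hswap : Function.Involutive swap := by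
    rintro ⟨f, i⟩
    simp [swap]
  have hnonneg : ∀ f, 0 ≤ (∏ k, x (f k)) * D f := fun f =>
    mul_nonneg (Finset.prod_nonneg fun k _ => (hx _).1) (sq_nonneg _)
  calc (d : ℝ) * ∑ f : Fin d → Fin n,
        (if Function.Injective f then (∏ k, x (f k)) * D f else 0)
      = ∑ p : (Fin d → Fin n) × Fin n,
          x p.2 * (if Function.Injective p.1 then (∏ k, x (p.1 k)) * D p.1 else 0) := by
        rw [Fintype.sum_prod_type_right, ← hsum, Finset.sum_mul]
        simp only [Finset.mul_sum]
    _ = ∑ p : (Fin d → Fin n) × Fin n, x (swap p).2 *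
          (if Function.Injective (swap p).1 then
            (∏ k, x ((swap p).1 k)) * D (swap p).1 else 0) :=
        (Equiv.sum_comp hswap.toPerm fun p : (Fin d → Fin n) × Fin n =>
          x p.2 * (if Function.Injective p.1 then (∏ k, x (p.1 k)) * D p.1 else 0)).symm
    _ = ∑ f : Fin d → Fin n, (∏ k, x (f k)) * D f *
          ∑ i, (if Function.Injective (Function.update f j i) then x i else 0) := by
        rw [Fintype.sum_prod_type]
        refine Finset.sum_congr rfl fun f _ => ?_
        rw [Finset.mul_sum]
        refine Finset.sum_congr rfl fun i _ => ?_
        by_cases h : Function.Injective (Function.update f j i)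
        · simp only [swap, h, if_true]
          rw [hprod, hprod, hP, hD]
          simp
          ring
        · simp [swap, h]
    _ ≤ ∑ f : Fin d → Fin n, (∏ k, x (f k)) * D f * min (d : ℝ) ((n : ℝ) - d + 1) :=
        Finset.sum_le_sum fun f _ => mul_le_mul_of_nonneg_left
          (sum_injective_update_le hx hsum hdn f j) (hnonneg f)
    _ = min (d : ℝ) ((n : ℝ) - d + 1) * ∑ f : Fin d → Fin n, (∏ k, x (f k)) * D f := by
        rw [← Finset.sum_mul, mul_comm]

/-- A ridge-regularized inverse is bounded by any splitting of the vector it is applied to. -/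
theorem dotProduct_le_of_regularized {C : Matrix (Fin d) (Fin d) ℝ}
    {lam : ℝ} (hlam : 0 < lam) {v w y : Fin d → ℝ}
    (hy : (C.transpose * C + lam • (1 : Matrix (Fin d) (Fin d) ℝ)) *ᵥ y = v + w) :
    C.det ^ 2 * ((v + w) ⬝ᵥ y) ≤
      ∑ j, (C.updateRow j v).det ^ 2 + C.det ^ 2 * ((w ⬝ᵥ w) / lam) := by
  -- Division-free stand-in for `det C • C⁻ᵀ v`, so `C` may be singular.
  set q : Fin d → ℝ := Matrix.cramer C.transpose v with hq
  have hqv : C.transpose *ᵥ q = C.det • v := by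
    rw [hq, Matrix.mulVec_cramer, Matrix.det_transpose]
  have hsumq : ∑ j, (C.updateRow j v).det ^ 2 = q ⬝ᵥ q := by
    simp only [hq, dotProduct, Matrix.cramer_transpose_apply, sq]
  have hvy : C.det * (v ⬝ᵥ y) = q ⬝ᵥ (C *ᵥ y) := by
    rw [Matrix.dotProduct_mulVec, ← Matrix.mulVec_transpose, hqv, smul_dotProduct, smul_eq_mul]
  have hyy : (v + w) ⬝ᵥ y = (C *ᵥ y) ⬝ᵥ (C *ᵥ y) + lam * (y ⬝ᵥ y) := by
    rw [← hy, Matrix.add_mulVec, add_dotProduct, ← Matrix.mulVec_mulVec,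
      Matrix.mulVec_transpose, ← Matrix.dotProduct_mulVec, Matrix.smul_mulVec,
      Matrix.one_mulVec, smul_dotProduct, smul_eq_mul]
  have h1 : 2 * C.det * (q ⬝ᵥ (C *ᵥ y)) ≤
      q ⬝ᵥ q + C.det ^ 2 * ((C *ᵥ y) ⬝ᵥ (C *ᵥ y)) := by
    simp only [dotProduct, Finset.mul_sum, ← Finset.sum_add_distrib]
    exact Finset.sum_le_sum fun i _ => by nlinarith [sq_nonneg (q i - C.det * (C *ᵥ y) i)]
  have h2 : 2 * (w ⬝ᵥ y) ≤ (w ⬝ᵥ w) / lam + lam * (y ⬝ᵥ y) := by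
    simp only [dotProduct, Finset.mul_sum, Finset.sum_div, ← Finset.sum_add_distrib]
    refine Finset.sum_le_sum fun i _ => ?_
    have : w i * w i / lam + lam * (y i * y i) - 2 * (w i * y i) =
        (w i - lam * y i) ^ 2 / lam := by
      field_simp
      ring
    have : 0 ≤ (w i - lam * y i) ^ 2 / lam := by positivity
    linarith
  have h3 := mul_le_mul_of_nonneg_left h2 (sq_nonneg C.det)
  rw [add_dotProduct] at hyy ⊢
  rw [hsumq]
  have h4 : C.det ^ 2 * (v ⬝ᵥ y) = C.det * (q ⬝ᵥ (C *ᵥ y)) := by rw [← hvy]; ring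
  have h5 : C.det ^ 2 * (v ⬝ᵥ y + w ⬝ᵥ y) =
      C.det ^ 2 * ((C *ᵥ y) ⬝ᵥ (C *ᵥ y)) + C.det ^ 2 * (lam * (y ⬝ᵥ y)) := by
    rw [hyy]; ring
  linarith

theorem raodRIObjective_eq (a : Fin n → Fin d → ℝ) (lam : ℝ) (x : Fin n → ℝ) :
    raodRIObjective a lam x =
      (informationMatrix a x + lam • (1 : Matrix (Fin d) (Fin d) ℝ))⁻¹.trace :=
  rfl

theorem raodObjective_eq_indicator (a : Fin n → Fin d → ℝ) (lam : ℝ) (S : Finset (Fin n)) :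
    raodObjective a lam S = raodRIObjective a lam (fun i => if i ∈ S then 1 else 0) := by
  simp [raodObjective, raodRIObjective, ite_smul, Finset.sum_ite_mem]

theorem raodRIObjective_pos (hd : 1 ≤ d) (a : Fin n → Fin d → ℝ) {lam : ℝ} (hlam : 0 < lam)
    {x : Fin n → ℝ} (hx : ∀ i, 0 ≤ x i) : 0 < raodRIObjective a lam x := by
  have : Nonempty (Fin d) := ⟨⟨0, hd⟩⟩
  exact (informationMatrix_add_posDef a hx hlam).inv.trace_pos

/-- Joint continuity serves twice: in `a` for the perturbation argument, in `x` for attainment. -/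
theorem continuousAt_raodRIObjective (a : Fin n → Fin d → ℝ) {lam : ℝ} (hlam : 0 < lam)
    {x : Fin n → ℝ} (hx : ∀ i, 0 ≤ x i) :
    ContinuousAt (fun p : (Fin n → Fin d → ℝ) × (Fin n → ℝ) => raodRIObjective p.1 lam p.2)
      (a, x) := by
  have hM : Continuous fun p : (Fin n → Fin d → ℝ) × (Fin n → ℝ) =>
      informationMatrix p.1 p.2 + lam • (1 : Matrix (Fin d) (Fin d) ℝ) := by
    refine Continuous.add (continuous_matrix fun k l => ?_) continuous_const
    simp only [informationMatrix_apply]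
    fun_prop
  have hdet := (informationMatrix_add_posDef a hx hlam).det_pos.ne'
  simp only [raodRIObjective_eq, Matrix.inv_def, Matrix.trace_smul, Ring.inverse_eq_inv',
    smul_eq_mul]
  exact (hM.matrix_det.continuousAt.inv₀ hdet).mul hM.matrix_adjugate.matrix_trace.continuousAt

/-- Trace bound for one tuple of experiments. -/
theorem det_sq_mul_raodObjective_le (a : Fin n → Fin d → ℝ) {lam : ℝ} (hlam : 0 < lam)
    {f : Fin d → Fin n} (hf : Function.Injective f) (v w : Fin d → Fin d → ℝ)
    (hvw : ∀ c, v c + w c = Pi.single c 1) :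
    (Matrix.of fun k => a (f k)).det ^ 2 * raodObjective a lam (Finset.univ.image f) ≤
      ∑ c, (∑ j, ((Matrix.of fun k => a (f k)).updateRow j (v c)).det ^ 2 +
        (Matrix.of fun k => a (f k)).det ^ 2 * ((w c ⬝ᵥ w c) / lam)) := by
  set C : Matrix (Fin d) (Fin d) ℝ := Matrix.of fun k => a (f k) with hC
  set M := C.transpose * C + lam • (1 : Matrix (Fin d) (Fin d) ℝ) with hM
  have hMpos : M.PosDef := by
    refine Matrix.PosDef.posSemidef_add ?_ (Matrix.PosDef.one.smul hlam)
    simpa using Matrix.posSemidef_conjTranspose_mul_self C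
  have hobj : raodObjective a lam (Finset.univ.image f) = M⁻¹.trace := by
    have : ∑ i ∈ Finset.univ.image f, Matrix.vecMulVec (a i) (a i) = C.transpose * C := by
      rw [Finset.sum_image hf.injOn]
      ext k l
      simp [Matrix.sum_apply, Matrix.vecMulVec_apply, Matrix.mul_apply, hC]
    rw [raodObjective, this]
  rw [hobj, Matrix.trace, Finset.mul_sum]
  refine Finset.sum_le_sum fun c _ => ?_
  have hy : M *ᵥ (M⁻¹ *ᵥ Pi.single c 1) = v c + w c := by
    rw [Matrix.mulVec_mulVec, Matrix.mul_nonsing_inv _ hMpos.det_pos.ne'.isUnit,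
      Matrix.one_mulVec, hvw]
  have h := dotProduct_le_of_regularized hlam hy
  rw [hvw] at h
  simpa using h

/-- Volume sampling bound for a nonsingular fractional design. -/
theorem exists_raodObjective_le_of_det_ne_zero (hd : 1 ≤ d) (hdn : d ≤ n)
    (a : Fin n → Fin d → ℝ) {lam : ℝ} (hlam : 0 < lam) {x : Fin n → ℝ}
    (hx : ∀ i, x i ∈ Set.Icc (0 : ℝ) 1) (hsum : ∑ i, x i = d)
    (hdet : (informationMatrix a x).det ≠ 0) :
    ∃ S : Finset (Fin n), S.card = d ∧ raodObjective a lam S ≤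
      min (d : ℝ) ((n : ℝ) - d + 1) * raodRIObjective a lam x := by
  classical
  set β := min (d : ℝ) ((n : ℝ) - d + 1)
  have hβ : 1 ≤ β := le_min (by exact_mod_cast hd) (by
    have : (d : ℝ) ≤ n := by exact_mod_cast hdn
    linarith)
  have hx0 : ∀ i, 0 ≤ x i := fun i => (hx i).1
  have hd0 : (0 : ℝ) < d := by exact_mod_cast hd
  set A := informationMatrix a x with hA
  have hApos : 0 < A.det :=
    lt_of_le_of_ne (informationMatrix_posSemidef a hx0).det_nonneg hdet.symm
  set M := A + lam • (1 : Matrix (Fin d) (Fin d) ℝ) with hM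
  have hMpos : M.PosDef := informationMatrix_add_posDef a hx0 hlam
  set z : Fin d → Fin d → ℝ := fun c => M⁻¹ *ᵥ Pi.single c 1 with hz
  have hvw : ∀ c, A *ᵥ z c + lam • z c = Pi.single c 1 := by
    intro c
    have : M *ᵥ z c = Pi.single c 1 := by
      rw [hz, Matrix.mulVec_mulVec, Matrix.mul_nonsing_inv _ hMpos.det_pos.ne'.isUnit,
        Matrix.one_mulVec]
    rw [← this, hM, Matrix.add_mulVec, Matrix.smul_mulVec, Matrix.one_mulVec]
  have htrace : raodRIObjective a lam x = ∑ c, (A *ᵥ z c + lam • z c) ⬝ᵥ z c := by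
    rw [raodRIObjective_eq, Matrix.trace]
    exact Finset.sum_congr rfl fun c _ => by rw [hvw]; simp [z, M, A]
  set K := (d.factorial : ℝ) * A.det with hK
  have hKpos : 0 < K := by positivity
  let C : (Fin d → Fin n) → Matrix (Fin d) (Fin d) ℝ := fun f => Matrix.of fun k => a (f k)
  let p : (Fin d → Fin n) → ℝ := fun f => ∏ k, x (f k)
  have hp : ∀ f, 0 ≤ p f := fun f => Finset.prod_nonneg fun k _ => hx0 _
  let I : Finset (Fin d → Fin n) := Finset.univ.filter Function.Injective
  have hIK : ∑ f ∈ I, p f * (C f).det ^ 2 = K := by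
    rw [hK, ← sum_volume_weights a x, Finset.sum_filter]
    refine Finset.sum_congr rfl fun f _ => ?_
    split_ifs with hf
    · rfl
    · obtain ⟨k, l, hkl, hne⟩ := Function.not_injective_iff.1 hf
      have : (Matrix.of fun k => a (f k)).det = 0 :=
        Matrix.det_zero_of_row_eq hne (by ext; simp [hkl])
      simp [this]
  have hQ : ∀ c, ∑ j, ∑ f ∈ I, p f * ((C f).updateRow j (A *ᵥ z c)).det ^ 2 ≤
      β * (K * (A *ᵥ z c ⬝ᵥ z c)) := by
    intro c
    refine le_of_mul_le_mul_left ?_ hd0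
    rw [Finset.mul_sum]
    calc _ ≤ ∑ j, β * ∑ f : Fin d → Fin n, p f * ((C f).updateRow j (A *ᵥ z c)).det ^ 2 := by
          refine Finset.sum_le_sum fun j _ => ?_
          rw [Finset.sum_filter]
          exact sum_injective_det_updateRow_sq_le hx hsum hdn a _ j
      _ = _ := by
          rw [← Finset.mul_sum, sum_det_updateRow_sq a x (z c), hsum, hK]
          ring
  -- The best set replaces the random one: its value is at most that of every sampled tuple.
  obtain ⟨S, hS, hmin⟩ := Finset.exists_min_image
    (Finset.powersetCard d (Finset.univ : Finset (Fin n))) (raodObjective a lam)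
    (Finset.powersetCard_nonempty.2 (by simpa using hdn))
  refine ⟨S, (Finset.mem_powersetCard.1 hS).2, le_of_mul_le_mul_left ?_ hKpos⟩
  calc K * raodObjective a lam S
      = ∑ f ∈ I, p f * ((C f).det ^ 2 * raodObjective a lam S) := by
        rw [← hIK, Finset.sum_mul]
        exact Finset.sum_congr rfl fun f _ => by ring
    _ ≤ ∑ f ∈ I, p f * ∑ c, (∑ j, ((C f).updateRow j (A *ᵥ z c)).det ^ 2 +
          (C f).det ^ 2 * ((lam • z c ⬝ᵥ lam • z c) / lam)) := by
        refine Finset.sum_le_sum fun f hf => mul_le_mul_of_nonneg_left ?_ (hp f)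
        have hf : Function.Injective f := (Finset.mem_filter.1 hf).2
        refine le_trans (mul_le_mul_of_nonneg_left (hmin (Finset.univ.image f) ?_)
          (sq_nonneg _)) (det_sq_mul_raodObjective_le a hlam hf _ _ hvw)
        simp [Finset.mem_powersetCard, Finset.card_image_of_injective _ hf]
    _ = ∑ c, (∑ j, ∑ f ∈ I, p f * ((C f).updateRow j (A *ᵥ z c)).det ^ 2 +
          K * (lam * (z c ⬝ᵥ z c))) := by
        simp_rw [Finset.mul_sum]
        rw [Finset.sum_comm]
        refine Finset.sum_congr rfl fun c _ => ?_
        rw [Finset.sum_comm (s := Finset.univ), ← hIK, Finset.sum_mul,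
          ← Finset.sum_add_distrib]
        refine Finset.sum_congr rfl fun f _ => ?_
        rw [mul_add, Finset.mul_sum]
        congr 1
        simp only [smul_dotProduct, dotProduct_smul, smul_eq_mul]
        field_simp
    _ ≤ ∑ c, β * (K * ((A *ᵥ z c + lam • z c) ⬝ᵥ z c)) := by
        refine Finset.sum_le_sum fun c _ => ?_
        -- The regularization part carries factor 1; since `1 ≤ β`, it is absorbed into the common
        -- factor `β`.
        have h0 : 0 ≤ K * (lam * (z c ⬝ᵥ z c)) := by
          have : 0 ≤ z c ⬝ᵥ z c := Finset.sum_nonneg fun i _ => mul_self_nonneg _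
          positivity
        rw [add_dotProduct, smul_dotProduct, smul_eq_mul]
        nlinarith [hQ c]
    _ = K * (β * raodRIObjective a lam x) := by
        rw [htrace, Finset.mul_sum, Finset.mul_sum]
        exact Finset.sum_congr rfl fun c _ => by ring

/-! ### Removing the nonsingularity assumption -/

/-- A fractional design of total weight `d` has full rank for some choice of the vectors. -/
theorem exists_det_informationMatrix_ne_zero {x : Fin n → ℝ}
    (hx : ∀ i, x i ∈ Set.Icc (0 : ℝ) 1) (hsum : ∑ i, x i = d) :
    ∃ b : Fin n → Fin d → ℝ, (informationMatrix b x).det ≠ 0 := by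
  classical
  set G := Finset.univ.filter fun i => x i ≠ 0 with hG
  -- Weights at most 1 with sum `d` have at least `d` nonzero entries; standard basis vectors placed
  -- there make the matrix diagonal.
  have hcard : d ≤ G.card := by
    have : (d : ℝ) ≤ G.card := by
      rw [← hsum, ← Finset.sum_filter_ne_zero]
      calc ∑ i ∈ G, x i ≤ ∑ i ∈ G, (1 : ℝ) := Finset.sum_le_sum fun i _ => (hx i).2
        _ = G.card := by simp
    exact_mod_cast this
  let e : Fin d ↪ Fin n := (Fin.castLEEmb hcard).trans (G.orderEmbOfFin rfl).toEmbedding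
  have he : ∀ k, x (e k) ≠ 0 := fun k =>
    (Finset.mem_filter.1 (G.orderEmbOfFin_mem rfl (Fin.castLE hcard k))).2
  refine ⟨fun i k => if e k = i then 1 else 0, ?_⟩
  have : informationMatrix (fun i k => if e k = i then (1 : ℝ) else 0) x =
      Matrix.diagonal fun k => x (e k) := by
    ext k l
    by_cases hkl : k = l
    · subst hkl
      simp [informationMatrix_apply]
    · simp [informationMatrix_apply, hkl]
  rw [this, Matrix.det_diagonal]
  exact Finset.prod_ne_zero_iff.2 fun k _ => he k

/-- Along the segment from `a` to `b` the determinant is a polynomial in `t`, nonzero at `t = 1`,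
hence with finitely many roots. -/
theorem eventually_det_informationMatrix_ne_zero (a b : Fin n → Fin d → ℝ) (x : Fin n → ℝ)
    (hb : (informationMatrix b x).det ≠ 0) :
    ∀ᶠ t : ℝ in nhdsWithin 0 {0}ᶜ, (informationMatrix (a + t • (b - a)) x).det ≠ 0 := by
  let Q : Polynomial ℝ := (Matrix.of fun k l : Fin d => ∑ i, Polynomial.C (x i) *
    (Polynomial.C (a i k) + Polynomial.X * Polynomial.C (b i k - a i k)) *
    (Polynomial.C (a i l) + Polynomial.X * Polynomial.C (b i l - a i l))).det
  have hQ : ∀ t, Q.eval t = (informationMatrix (a + t • (b - a)) x).det := by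
    intro t
    rw [← Polynomial.coe_evalRingHom, RingHom.map_det]
    congr 1
    ext k l
    simp [informationMatrix_apply, Polynomial.eval_finsetSum]
  have hQ0 : Q ≠ 0 := by
    intro h
    apply hb
    have := hQ 1
    rw [h] at this
    simpa using this.symm
  have hfin : ({t : ℝ | Q.IsRoot t} \ {0}).Finite :=
    (Polynomial.finite_setOfPred_isRoot hQ0).subset Set.sdiff_subset
  have hnhds : ({t : ℝ | Q.IsRoot t} \ {0})ᶜ ∈ nhds (0 : ℝ) :=
    hfin.isClosed.isOpen_compl.mem_nhds (by simp)
  filter_upwards [mem_nhdsWithin_of_mem_nhds hnhds, self_mem_nhdsWithin] with t ht ht0 h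
  exact ht ⟨by simpa [Polynomial.IsRoot, hQ] using h, ht0⟩

/-- If every set failed strictly at `a`, then, there being finitely many sets, all would still fail
at nearby vectors, some of which give a nonsingular design. -/
theorem exists_raodObjective_le (hd : 1 ≤ d) (hdn : d ≤ n)
    (a : Fin n → Fin d → ℝ) {lam : ℝ} (hlam : 0 < lam) {x : Fin n → ℝ}
    (hx : ∀ i, x i ∈ Set.Icc (0 : ℝ) 1) (hsum : ∑ i, x i = d) :
    ∃ S : Finset (Fin n), S.card = d ∧ raodObjective a lam S ≤
      min (d : ℝ) ((n : ℝ) - d + 1) * raodRIObjective a lam x := by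
  obtain ⟨b, hb⟩ := exists_det_informationMatrix_ne_zero hx hsum
  by_contra! hcon
  have hcont : ∀ y : Fin n → ℝ, (∀ i, 0 ≤ y i) → Filter.Tendsto
      (fun t : ℝ => raodRIObjective (a + t • (b - a)) lam y) (nhdsWithin 0 {0}ᶜ)
      (nhds (raodRIObjective a lam y)) := by
    intro y hy
    have hpath : ContinuousAt (fun t : ℝ => (a + t • (b - a), y)) 0 := by fun_prop
    have hcomp := ContinuousAt.comp_of_eq (continuousAt_raodRIObjective a hlam hy) hpath
      (by simp)
    have htend := hcomp.tendsto.mono_left (nhdsWithin_le_nhds (s := {0}ᶜ))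
    simpa only [Function.comp_def, zero_smul, add_zero] using htend
  have hev : ∀ᶠ t : ℝ in nhdsWithin 0 {0}ᶜ, ∀ S : Finset (Fin n), S.card = d →
      min (d : ℝ) ((n : ℝ) - d + 1) * raodRIObjective (a + t • (b - a)) lam x <
        raodObjective (a + t • (b - a)) lam S := by
    refine Filter.eventually_all.2 fun S => ?_
    by_cases hS : S.card = d
    · have h := hcon S hS
      simp only [raodObjective_eq_indicator] at h ⊢
      filter_upwards [((hcont x fun i => (hx i).1).const_mul _).eventually_lt
        (hcont _ fun i => by split_ifs <;> norm_num) h] with t ht _ using ht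
    · exact Filter.Eventually.of_forall fun t h => absurd h hS
  obtain ⟨t, ht, htdet⟩ :=
    (hev.and (eventually_det_informationMatrix_ne_zero a b x hb)).exists
  obtain ⟨S, hS, hle⟩ := exists_raodObjective_le_of_det_ne_zero hd hdn _ hlam hx hsum htdet
  exact (ht S hS).not_ge hle

/-! ### Attainment of both minima -/

theorem isLeast_raodOpt (hdn : d ≤ n) (a : Fin n → Fin d → ℝ) (lam : ℝ) :
    IsLeast (raodValues a lam d) (raodOpt a lam d) := by
  have hne : (raodValues a lam d).Nonempty := by
    obtain ⟨S, -, hS⟩ := Finset.exists_subset_card_eq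
      (s := (Finset.univ : Finset (Fin n))) (n := d) (by simpa using hdn)
    exact ⟨_, S, hS, rfl⟩
  have hfin : (raodValues a lam d).Finite := (Set.toFinite _).image _
  exact ⟨hne.csInf_mem hfin, fun y hy => csInf_le hfin.bddBelow hy⟩

theorem raodValues_subset_raodRIValues (a : Fin n → Fin d → ℝ) (lam : ℝ) (k : ℕ) :
    raodValues a lam k ⊆ raodRIValues a lam k := by
  rintro _ ⟨S, hS, rfl⟩
  refine ⟨fun i => if i ∈ S then 1 else 0, ⟨fun i => ?_, ?_⟩,
    (raodObjective_eq_indicator a lam S).symm⟩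
  · by_cases h : i ∈ S <;> simp [h]
  · have hS : S.card = k := hS
    simp [hS]

theorem isLeast_raodRIOpt (hdn : d ≤ n) (a : Fin n → Fin d → ℝ) {lam : ℝ} (hlam : 0 < lam) :
    IsLeast (raodRIValues a lam d) (raodRIOpt a lam d) := by
  have hne : (raodRIValues a lam d).Nonempty :=
    ⟨_, raodValues_subset_raodRIValues a lam d (isLeast_raodOpt hdn a lam).1⟩
  have hdom : IsCompact
      {x : Fin n → ℝ | (∀ i, x i ∈ Set.Icc (0 : ℝ) 1) ∧ ∑ i, x i = (d : ℝ)} := by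
    have h1 : IsCompact (Set.univ.pi fun _ : Fin n => Set.Icc (0 : ℝ) 1) :=
      isCompact_univ_pi fun _ => isCompact_Icc
    have h2 : IsClosed {x : Fin n → ℝ | ∑ i, x i = (d : ℝ)} :=
      isClosed_eq (by fun_prop) continuous_const
    convert h1.inter_right h2 using 1
    ext x
    simp only [Set.mem_ofPred_eq, Set.mem_inter_iff, Set.mem_univ_pi]
  have hcomp : IsCompact (raodRIValues a lam d) := by
    refine hdom.image_of_continuousOn fun x hx => ContinuousAt.continuousWithinAt ?_
    exact (continuousAt_raodRIObjective a hlam fun i => (hx.1 i).1).comp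
      (f := fun y : Fin n → ℝ => (a, y)) (by fun_prop)
  exact hcomp.isLeast_sInf hne

end VolumeSampling

/-- The first three conjuncts say that both optimal values are attained minima and that the
denominator of the ratio is positive; the last two are the optimality gap at `k = d`. -/
theorem corollary4 (n d : ℕ) (hd : 1 ≤ d) (hdn : d ≤ n) (a : Fin n → Fin d → ℝ)
    (lam : ℝ) (hlam : 0 < lam) :
    IsLeast (raodValues a lam d) (raodOpt a lam d) ∧
    IsLeast (raodRIValues a lam d) (raodRIOpt a lam d) ∧
    0 < raodRIOpt a lam d ∧
    1 ≤ raodOpt a lam d / raodRIOpt a lam d ∧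
    raodOpt a lam d / raodRIOpt a lam d ≤ min (d : ℝ) ((n : ℝ) - (d : ℝ) + 1) := by
  have hz := isLeast_raodOpt hdn a lam
  have hν := isLeast_raodRIOpt hdn a hlam
  obtain ⟨x, ⟨hx, hsum⟩, hxν⟩ := hν.1
  have hpos : 0 < raodRIOpt a lam d := hxν ▸ raodRIObjective_pos hd a hlam fun i => (hx i).1
  refine ⟨hz, hν, hpos, ?_, ?_⟩
  · rw [one_le_div hpos]
    exact hν.2 (raodValues_subset_raodRIValues a lam d hz.1)
  · rw [div_le_iff₀ hpos, ← hxν]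
    obtain ⟨S, hS, hle⟩ := exists_raodObjective_le hd hdn a hlam hx hsum
    exact (hz.2 ⟨S, hS, rfl⟩).trans hle
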